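/- **Model.** A quantum switch has $N$ clients, $M$ quantum memories and $R$ request types; a request of type $r$ involves a set $\Omega(r)\subseteq\{1,\dots,N\}$ of at least two clients. In every time slot $t$ the switch receives requests $A(t)\in\{0,1\}^R$ and 1. chooses a memory allocation $m(t)\in\mathcal M=\{m\in\{0,1\}^N:\sum_n m_n\le M\}$; 2. attempts to create link-level entanglements: given $m(t)=m$ and everything that happened before, the connectivity $k(t)$ equals $k\in\mathcal K(m)=\{k\in\{0,1\}^N: k_n=0 \text{ whenever } m_n=0\}$ with probability $\mathbb P(k;m)$, where $\mathbb P(\cdot\,;m)$ is a given probability distribution on $\mathcal K(m)$ with $\mathbb P(k_n=1;m)=p_n$ for every $n$ with $m_n=1$ (for example, but not necessarily, independent attempts); 3. chooses a service vector $b(t)\in\mathcal B(m(t),k(t))$, where $\mathcal B(m,k)$ is the set of $b\in\{0,1\}^R$ for which there is a matrix $s\in\{0,1\}^{R\times N}$ such that, for every $r$, ($s_{rn}=1$ for all $n\in\Omega(r)$) iff $b_r=1$, and $\sum_r s_{rn}\le k_n$ for all $n$. Entanglements last for one slot only. A policy $\pi$ specifies the choices 1 and 3, possibly at random, as functions of $t$,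 of all that was observed in the previous slots, of $A(t)$, and (in 3) of $m(t)$ and $k(t)$. The arrival process is exogenous. Say that $\pi$ has the long-term service vector $f^\pi\in\mathbb R^R$ if $\frac1T\sum_{t=1}^T b(t)\to f^\pi$ almost surely. An arrival process has rate $\lambda$ if $\frac1T\sum_{t=1}^T A(t)\to\lambda$ almost surely. It is supported by the switch if some policy has a long-term service vector $f^\pi$ with $\lambda_r\le f^\pi_r$ for all $r$. **Proposition (quantum switch capacity region).** Let $\Lambda$ be the set of all vectors $$\sum_{m\in\mathcal M}\theta_m\sum_{k\in\mathcal K(m)}\mathbb P(k;m)\sum_{b\in\mathcal B(m,k)}\delta^{m,k}_b\,b$$ with $\theta_m\ge0$, $\sum_{m\in\mathcal M}\theta_m=1$, $\delta^{m,k}_b\ge0$ and $\sum_{b\in\mathcal B(m,k)}\delta^{m,k}_b=1$ for all $m\in\mathcal M$, $k\in\mathcal K(m)$, $b\in\mathcal B(m,k)$. Then: 1. Under any arrival process, the set of long-term service vectors $f^\pi$ of the policies $\pi$ is exactly $\Lambda$. 2. Under any arrival process and any policy, almost surely, if $\frac1T\sum_{t=1}^T b(t)$ converges, then its (possibly random)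 limit lies in $\Lambda$. 3. An arrival process with rate $\lambda$ is supported by the switch if and only if $\lambda\in\Lambda$; and the set of rates of the arrival processes that are supported is exactly $\Lambda$. -/

import Mathlib

/-- Binary vectors, i.e. elements of `{0,1}^n`. -/
abbrev BinVec (n : ℕ) : Type := Fin n → Fin 2

/-- A binary vector regarded as a vector of real numbers. -/
def BinVec.toReal {n : ℕ} (v : BinVec n) : Fin n → ℝ := fun i => ((v i : ℕ) : ℝ)

/-- A quantum switch with `N` clients and `R` request types: `M` quantum memories, the set `Ω r` of
(two or more) clients involved in a request of type `r`, and the success probabilities `p n` of the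
link-level entanglement (LLE) attempts.

`connLaw m` is the probability distribution of the connectivity `k` resulting from the memory
allocation `m`: a client without memory never obtains an LLE, and the attempt with a client `n`
holding a memory succeeds with probability `p n`. Any joint distribution with these marginals
is allowed; independent attempts are the most important example. -/
structure QuantumSwitch (N R : ℕ) where
  M : ℕ
  Ω : Fin R → Finset (Fin N)
  two_le_card : ∀ r, 2 ≤ (Ω r).card
  p : Fin N → ℝ
  p_mem : ∀ n, p n ∈ Set.Icc (0 : ℝ) 1
  connLaw : BinVec N → PMF (BinVec N)
  connLaw_no_memory : ∀ m : BinVec N, ∑ n, (m n : ℕ) ≤ M →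
    ∀ k ∈ (connLaw m).support, ∀ n, m n = 0 → k n = 0
  connLaw_marginal : ∀ m : BinVec N, ∑ n, (m n : ℕ) ≤ M →
    ∀ n, m n = 1 → ∑ k : BinVec N with k n = 1, (connLaw m k).toReal = p n

/-- What happens in one time slot: arrivals `A(t)`, memory allocation `m(t)`, connectivity `k(t)`
and service vector `b(t)`. -/
abbrev Slot (N R : ℕ) : Type := BinVec R × BinVec N × BinVec N × BinVec R

namespace QuantumSwitch

variable {N R : ℕ} (S : QuantumSwitch N R)

/-- The set `𝓜` of eligible memory allocations. -/
def allocations : Finset (BinVec N) :=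
  Finset.univ.filter fun m => ∑ n, (m n : ℕ) ≤ S.M

/-- The set `𝓚(m)` of connectivities that are possible under the memory allocation `m`. -/
def connectivities (_S : QuantumSwitch N R) (m : BinVec N) : Finset (BinVec N) :=
  Finset.univ.filter fun k => ∀ n, m n = 0 → k n = 0

open Classical in
/-- The set `𝓑(m, k)` of admissible service vectors: there is a binary `R × N` matrix `s`
(`s r n = 1`: the LLE of client `n` is used for request `r`) such that `b r = 1` iff all clients
of `r` are assigned to `r`, and every LLE is used at most once and only if it is active. -/
noncomputable def services (_m k : BinVec N) : Finset (BinVec R) :=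
  Finset.univ.filter fun b => ∃ s : Matrix (Fin R) (Fin N) (Fin 2),
    (∀ r, (∀ n ∈ S.Ω r, s r n = 1) ↔ b r = 1) ∧ ∀ n, ∑ r, (s r n : ℕ) ≤ (k n : ℕ)

/-- The probability `ℙ(k; m)` of the connectivity `k` under the memory allocation `m`. -/
noncomputable def connProb (k m : BinVec N) : ℝ := (S.connLaw m k).toReal

/-- The set `Λ`. -/
def capacityRegion : Set (Fin R → ℝ) :=
  {f | ∃ (θ : BinVec N → ℝ) (δ : BinVec N → BinVec N → BinVec R → ℝ),
    (∀ m ∈ S.allocations, 0 ≤ θ m) ∧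
    ∑ m ∈ S.allocations, θ m = 1 ∧
    (∀ m ∈ S.allocations, ∀ k ∈ S.connectivities m, ∀ b ∈ S.services m k, 0 ≤ δ m k b) ∧
    (∀ m ∈ S.allocations, ∀ k ∈ S.connectivities m, ∑ b ∈ S.services m k, δ m k b = 1) ∧
    f = ∑ m ∈ S.allocations, θ m • ∑ k ∈ S.connectivities m, S.connProb k m •
          ∑ b ∈ S.services m k, δ m k b • b.toReal}

/-- A (possibly randomized, time-varying and history-dependent) policy. In slot `t`, knowing
everything that happened in the previous slots and the arrivals `a` of the current slot, it draws a
memory allocation `m`; after observing the connectivity `k` it draws a service vector that is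
admissible for `(m, k)`. -/
structure Policy where
  alloc : (t : ℕ) → (Fin t → Slot N R) → BinVec R → PMF (BinVec N)
  serve : (t : ℕ) → (Fin t → Slot N R) → BinVec R → BinVec N → BinVec N → PMF (BinVec R)
  alloc_mem : ∀ t h a, ∀ m ∈ (alloc t h a).support, m ∈ S.allocations
  serve_mem : ∀ t h a, ∀ m ∈ S.allocations, ∀ k ∈ S.connectivities m,
    ∀ b ∈ (serve t h a m k).support, b ∈ S.services m k

variable {S}

/-- The conditional probability that memory allocation, connectivity and service vector of slot `t`
are those of `x`, given the past `h` and given that the arrivals are those of `x`. -/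
noncomputable def Policy.stepProb (π : S.Policy) (t : ℕ) (h : Fin t → Slot N R) (x : Slot N R) :
    ENNReal :=
  π.alloc t h x.1 x.2.1 * S.connLaw x.2.1 x.2.2.1 * π.serve t h x.1 x.2.1 x.2.2.1 x.2.2.2

/-- `P` is the law (on the space of trajectories) of the switch operated with the policy `π`, when
the arrival process has law `ν`. These finite-dimensional distributions determine `P`. -/
def Policy.IsLaw (π : S.Policy) (ν : MeasureTheory.Measure (ℕ → BinVec R))
    (P : MeasureTheory.Measure (ℕ → Slot N R)) : Prop :=
  ∀ (T : ℕ) (x : ℕ → Slot N R),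
    P {ω | ∀ t < T, ω t = x t} =
      ν {a | ∀ t < T, a t = (x t).1} *
        ∏ t ∈ Finset.range T, π.stepProb t (fun i : Fin t => x i) (x t)

end QuantumSwitch

/-- The sequence of binary vectors `v` has the long-term average `f`. -/
def HasLongTermAverage {R : ℕ} (v : ℕ → BinVec R) (f : Fin R → ℝ) : Prop :=
  Filter.Tendsto (fun T : ℕ => (1 / (T : ℝ)) • ∑ t ∈ Finset.range T, (v t).toReal)
    Filter.atTop (nhds f)

/-- An arrival process with law `ν` has the long-term arrival rate `lam`, almost surely. -/
def HasArrivalRate {R : ℕ} (ν : MeasureTheory.Measure (ℕ → BinVec R)) (lam : Fin R → ℝ) : Prop :=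
  ∀ᵐ a ∂ν, HasLongTermAverage a lam

/-- The sequence of service vectors of a trajectory. -/
def serviceSeq {N R : ℕ} (ω : ℕ → Slot N R) : ℕ → BinVec R := fun t => (ω t).2.2.2

namespace QuantumSwitch

variable {N R : ℕ} (S : QuantumSwitch N R)

/-- `f = f^π`: under arrivals with law `ν`, the policy `π` has the long-term service vector `f`,
almost surely. -/
def Policy.HasServiceRate {S : QuantumSwitch N R} (π : S.Policy)
    (ν : MeasureTheory.Measure (ℕ → BinVec R)) (f : Fin R → ℝ) : Prop :=
  ∃ P : MeasureTheory.Measure (ℕ → Slot N R),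
    π.IsLaw ν P ∧ ∀ᵐ ω ∂P, HasLongTermAverage (serviceSeq ω) f

/-- `lam` can be supported under arrivals with law `ν`: some policy has a long-term service vector
that dominates `lam` component-wise. -/
def Supports (ν : MeasureTheory.Measure (ℕ → BinVec R)) (lam : Fin R → ℝ) : Prop :=
  ∃ (π : S.Policy) (f : Fin R → ℝ), π.HasServiceRate ν f ∧ ∀ r, lam r ≤ f r

/-- The set of all arrival rates that the switch can support. -/
def supportableRates : Set (Fin R → ℝ) :=
  {lam | ∃ ν : MeasureTheory.Measure (ℕ → BinVec R), MeasureTheory.IsProbabilityMeasure ν ∧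
    HasArrivalRate ν lam ∧ S.Supports ν lam}

end QuantumSwitch

namespace BinVec

/-! The parametrization of Λ is bilinear in θ and δ. In the joint weights w(m,k,b) = θ(m) ℙ(k;m)
δ(m,k,b) it becomes linear: the pairs (θ, w) form a compact convex polytope (`slotWeights`), and Λ
is its image under the linear map `meanService`. Hence Λ is convex and closed. It is also closed
under lowering coordinates to nonnegative values, since a switch may always decline to serve a
request.

Achievability: a point of Λ is the mean of a single-slot randomized rule. Repeating that rule
independently in every slot, independently of the arrivals, attains it by the strong law
(`exists_policy_hasServiceRate`).

Converse: given the past and the current arrivals, the conditional mean of b(t) lies in Λ, whatever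
the policy. The deviations from these means are bounded and orthogonal, so their averages tend to 0
almost surely along the squares. Any limit of service averages is therefore a limit of averages of
points of Λ, so it lies in Λ by convexity and closedness (`Policy.IsLaw.ae_mem_capacityRegion`). A
subsequence suffices because convergence of the full sequence is assumed. -/

@[simp] lemma toReal_apply {n : ℕ} (v : BinVec n) (i : Fin n) : v.toReal i = ((v i : ℕ) : ℝ) := rfl

lemma toReal_apply_nonneg {n : ℕ} (v : BinVec n) (i : Fin n) : 0 ≤ v.toReal i :=
  Nat.cast_nonneg _

lemma toReal_apply_le_one {n : ℕ} (v : BinVec n) (i : Fin n) : v.toReal i ≤ 1 := by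
  simp only [toReal_apply, Nat.cast_le_one]
  omega

end BinVec

/-! ### Geometry of Λ: linearization, convexity, closedness, lowering of coordinates -/

namespace QuantumSwitch

variable {N R : ℕ} (S : QuantumSwitch N R)

lemma exists_mem_Ω (r : Fin R) : ∃ n, n ∈ S.Ω r :=
  Finset.card_pos.mp (lt_of_lt_of_le two_pos (S.two_le_card r))

/-- Nonemptiness of `Ω r` matters: for an empty `Ω r` the condition on `s` would hold vacuously and
force `b r = 1`. -/
lemma zero_mem_services (m k : BinVec N) : (0 : BinVec R) ∈ S.services m k := by
  classical
  simp only [services, Finset.mem_filter, Finset.mem_univ, true_and]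
  refine ⟨0, fun r => ?_, fun n => by simp⟩
  obtain ⟨n, hn⟩ := S.exists_mem_Ω r
  simp only [Matrix.zero_apply, Pi.zero_apply, iff_false, zero_ne_one]
  exact fun h => h n hn

/-- Erasing row `r` of the assignment matrix withdraws request `r` and only frees entanglements; the
other rows are untouched. -/
lemma update_zero_mem_services {m k : BinVec N} {b : BinVec R} (hb : b ∈ S.services m k)
    (r : Fin R) : Function.update b r 0 ∈ S.services m k := by
  classical
  simp only [services, Finset.mem_filter, Finset.mem_univ, true_and] at hb ⊢
  obtain ⟨s, hs, hk⟩ := hb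
  refine ⟨fun r' n => if r' = r then 0 else s r' n, fun r' => ?_, fun n => le_trans ?_ (hk n)⟩
  · obtain ⟨n, hn⟩ := S.exists_mem_Ω r
    rcases eq_or_ne r' r with rfl | h
    · simp only [if_true, Function.update_self, zero_ne_one, iff_false]
      exact fun h => h n hn
    · simpa [h] using hs r'
  · refine Finset.sum_le_sum fun r' _ => ?_
    dsimp only
    split_ifs <;> simp

lemma connProb_nonneg (k m : BinVec N) : 0 ≤ S.connProb k m := ENNReal.toReal_nonneg

lemma connLaw_eq_zero {m k : BinVec N} (hm : m ∈ S.allocations) (hk : k ∉ S.connectivities m) :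
    S.connLaw m k = 0 := by
  by_contra h
  refine hk ?_
  simp only [allocations, connectivities, Finset.mem_filter, Finset.mem_univ, true_and] at hm ⊢
  exact S.connLaw_no_memory m hm k ((PMF.mem_support_iff _ _).2 h)

lemma connProb_eq_zero {m k : BinVec N} (hm : m ∈ S.allocations) (hk : k ∉ S.connectivities m) :
    S.connProb k m = 0 := by
  simp [connProb, S.connLaw_eq_zero hm hk]

/-- Joint weights of memory allocations (first component) and of triples of memory allocation,
connectivity and service vector (second component), as they arise in a single slot. -/
def slotWeights : Set ((BinVec N → ℝ) × (BinVec N → BinVec N → BinVec R → ℝ)) :=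
  {x | (∀ m, 0 ≤ x.1 m) ∧ (∀ m, m ∉ S.allocations → x.1 m = 0) ∧ ∑ m, x.1 m = 1 ∧
    (∀ m k b, 0 ≤ x.2 m k b) ∧ (∀ m k b, b ∉ S.services m k → x.2 m k b = 0) ∧
    ∀ m k, ∑ b, x.2 m k b = x.1 m * S.connProb k m}

/-- The mean service vector of joint weights. -/
def meanService (N R : ℕ) :
    (BinVec N → ℝ) × (BinVec N → BinVec N → BinVec R → ℝ) →ₗ[ℝ] (Fin R → ℝ) where
  toFun x := ∑ m, ∑ k, ∑ b, x.2 m k b • b.toReal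
  map_add' x y := by simp [add_smul, Finset.sum_add_distrib]
  map_smul' c x := by simp [mul_smul, Finset.smul_sum]

lemma meanService_apply (x : (BinVec N → ℝ) × (BinVec N → BinVec N → BinVec R → ℝ)) :
    meanService N R x = ∑ m, ∑ k, ∑ b, x.2 m k b • b.toReal := rfl

/-- The weights are θ(m) ℙ(k;m) δ(m,k,b), extended by zero because θ and δ are unconstrained off the
admissible sets. -/
lemma capacityRegion_subset_image : S.capacityRegion ⊆ meanService N R '' S.slotWeights := by
  classical
  rintro f ⟨θ, δ, hθ, hθ1, hδ, hδ1, rfl⟩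
  refine ⟨(fun m => if m ∈ S.allocations then θ m else 0, fun m k b =>
    if m ∈ S.allocations then if k ∈ S.connectivities m then if b ∈ S.services m k then
      θ m * S.connProb k m * δ m k b else 0 else 0 else 0), ⟨?_, ?_, ?_, ?_, ?_, ?_⟩, ?_⟩
  · intro m
    dsimp only
    split_ifs with h
    exacts [hθ m h, le_rfl]
  · intro m h
    simp [h]
  · simpa using hθ1
  · intro m k b
    dsimp only
    split_ifs with h h' h''
    · exact mul_nonneg (mul_nonneg (hθ m h) (S.connProb_nonneg k m)) (hδ m h k h' b h'')
    all_goals exact le_rfl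
  · intro m k b h
    simp [h]
  · intro m k
    dsimp only
    split_ifs with h h'
    · simp [← Finset.mul_sum, hδ1 m h k h']
    · simp [S.connProb_eq_zero h h']
    · simp
  · rw [meanService_apply, ← Finset.sum_subset (Finset.subset_univ S.allocations)]
    · refine Finset.sum_congr rfl fun m hm => ?_
      rw [← Finset.sum_subset (Finset.subset_univ (S.connectivities m)), Finset.smul_sum]
      · refine Finset.sum_congr rfl fun k hk => ?_
        rw [← Finset.sum_subset (Finset.subset_univ (S.services m k)), Finset.smul_sum,
          Finset.smul_sum]
        · refine Finset.sum_congr rfl fun b hb => ?_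
          simp [hm, hk, hb, mul_smul]
        · intro b _ hb
          simp [hb]
      · intro k _ hk
        simp [hk]
    · intro m _ hm
      simp [hm]

/-- Disintegration: δ is recovered as the conditional weight of b given (m,k). -/
lemma image_subset_capacityRegion : meanService N R '' S.slotWeights ⊆ S.capacityRegion := by
  classical
  rintro _ ⟨⟨θ, w⟩, ⟨hθ, hθ0, hθ1, hw, hw0, hw1⟩, rfl⟩
  dsimp only at hθ hθ0 hθ1 hw hw0 hw1
  have hsum : ∀ m k, ∑ b ∈ S.services m k, w m k b = θ m * S.connProb k m := fun m k => by
    rw [← hw1, Finset.sum_subset (Finset.subset_univ _)]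
    exact fun b _ hb => hw0 m k b hb
  have hzero : ∀ m k, θ m * S.connProb k m = 0 → ∀ b, w m k b = 0 := fun m k h b =>
    (Finset.sum_eq_zero_iff_of_nonneg fun b _ => hw m k b).1 ((hw1 m k).trans h) b
      (Finset.mem_univ b)
  -- Where the pair (m,k) has weight zero, any admissible distribution will do, since w vanishes
  -- there by `hzero`; the point mass at b = 0 is always available.
  refine ⟨θ, fun m k b => if θ m * S.connProb k m = 0 then if b = 0 then 1 else 0 else
    w m k b / (θ m * S.connProb k m), fun m _ => hθ m, ?_, ?_, ?_, ?_⟩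
  · rw [← hθ1, Finset.sum_subset (Finset.subset_univ _)]
    exact fun m _ hm => hθ0 m hm
  · intro m _ k _ b _
    dsimp only
    split_ifs
    · exact zero_le_one
    · exact le_rfl
    · exact div_nonneg (hw m k b) (mul_nonneg (hθ m) (S.connProb_nonneg k m))
  · intro m _ k _
    dsimp only
    split_ifs with h
    · simp [S.zero_mem_services]
    · rw [← Finset.sum_div, hsum, div_self h]
  · rw [meanService_apply, ← Finset.sum_subset (Finset.subset_univ S.allocations)]
    · refine Finset.sum_congr rfl fun m hm => ?_
      rw [← Finset.sum_subset (Finset.subset_univ (S.connectivities m)), Finset.smul_sum]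
      · refine Finset.sum_congr rfl fun k hk => ?_
        rw [← Finset.sum_subset (Finset.subset_univ (S.services m k)), Finset.smul_sum,
          Finset.smul_sum]
        · refine Finset.sum_congr rfl fun b hb => ?_
          rw [smul_smul, smul_smul]
          dsimp only
          by_cases h : θ m * S.connProb k m = 0
          · simp [hzero m k h b, h]
          · rw [if_neg h, mul_div_cancel₀ _ h]
        · intro b _ hb
          simp [hw0 m k b hb]
      · intro k _ hk
        simp [hzero m k (by simp [S.connProb_eq_zero hm hk])]
    · intro m _ hm
      simp [hzero m _ (by simp [hθ0 m hm])]

lemma capacityRegion_eq_image : S.capacityRegion = meanService N R '' S.slotWeights :=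
  (S.capacityRegion_subset_image).antisymm S.image_subset_capacityRegion

lemma convex_slotWeights : Convex ℝ S.slotWeights := by
  rintro x ⟨h1, h2, h3, h4, h5, h6⟩ y ⟨g1, g2, g3, g4, g5, g6⟩ a c ha hc hac
  refine ⟨fun m => ?_, fun m hm => ?_, ?_, fun m k b => ?_, fun m k b hb => ?_, fun m k => ?_⟩
  · exact add_nonneg (mul_nonneg ha (h1 m)) (mul_nonneg hc (g1 m))
  · simp [h2 m hm, g2 m hm]
  · simp [Finset.sum_add_distrib, ← Finset.mul_sum, h3, g3, hac]
  · exact add_nonneg (mul_nonneg ha (h4 m k b)) (mul_nonneg hc (g4 m k b))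
  · simp [h5 m k b hb, g5 m k b hb]
  · simp only [Prod.snd_add, Prod.smul_snd, Pi.add_apply, Pi.smul_apply, smul_eq_mul,
      Finset.sum_add_distrib, ← Finset.mul_sum, h6, g6, Prod.fst_add, Prod.smul_fst]
    ring

lemma isClosed_slotWeights : IsClosed S.slotWeights := by
  have h1 : ∀ m, Continuous
      fun x : (BinVec N → ℝ) × (BinVec N → BinVec N → BinVec R → ℝ) => x.1 m := fun m => by fun_prop
  have h2 : ∀ m k b, Continuous
      fun x : (BinVec N → ℝ) × (BinVec N → BinVec N → BinVec R → ℝ) => x.2 m k b :=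
    fun m k b => by fun_prop
  simp only [slotWeights, Set.ofPred_and, Set.ofPred_forall]
  refine IsClosed.inter ?_ (IsClosed.inter ?_ (IsClosed.inter ?_ (IsClosed.inter ?_
    (IsClosed.inter ?_ ?_))))
  · exact isClosed_iInter fun m => isClosed_le continuous_const (h1 m)
  · exact isClosed_iInter fun m => isClosed_iInter fun _ => isClosed_eq (h1 m) continuous_const
  · exact isClosed_eq (continuous_finsetSum _ fun m _ => h1 m) continuous_const
  · exact isClosed_iInter fun m => isClosed_iInter fun k => isClosed_iInter fun b =>
      isClosed_le continuous_const (h2 m k b)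
  · exact isClosed_iInter fun m => isClosed_iInter fun k => isClosed_iInter fun b =>
      isClosed_iInter fun _ => isClosed_eq (h2 m k b) continuous_const
  · exact isClosed_iInter fun m => isClosed_iInter fun k =>
      isClosed_eq (continuous_finsetSum _ fun b _ => h2 m k b) ((h1 m).mul continuous_const)

lemma isCompact_slotWeights : IsCompact S.slotWeights := by
  refine IsCompact.of_isClosed_subset (isCompact_Icc (a := 0) (b := 1)) S.isClosed_slotWeights ?_
  rintro x ⟨h1, -, h3, h4, -, h6⟩
  have hθ : ∀ m, x.1 m ≤ 1 := fun m => by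
    rw [← h3]
    exact Finset.single_le_sum (fun i _ => h1 i) (Finset.mem_univ m)
  refine ⟨⟨h1, h4⟩, ⟨hθ, fun m k b => ?_⟩⟩
  calc x.2 m k b ≤ ∑ b, x.2 m k b := Finset.single_le_sum (fun i _ => h4 m k i) (Finset.mem_univ b)
    _ = x.1 m * S.connProb k m := h6 m k
    _ ≤ 1 := mul_le_one₀ (hθ m) (S.connProb_nonneg k m)
      (ENNReal.toReal_le_of_le_ofReal zero_le_one (by simpa using PMF.coe_le_one _ _))

lemma convex_capacityRegion : Convex ℝ S.capacityRegion := by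
  rw [capacityRegion_eq_image]
  exact S.convex_slotWeights.linear_image _

lemma isClosed_capacityRegion : IsClosed S.capacityRegion := by
  rw [capacityRegion_eq_image]
  exact (S.isCompact_slotWeights.image
    (LinearMap.continuous_of_finiteDimensional _)).isClosed

/-- The joint weights are pushed forward along the map that erases request `r` from the service
vector; θ and the law of k are unchanged. -/
lemma update_zero_mem_capacityRegion {f : Fin R → ℝ} (hf : f ∈ S.capacityRegion) (r : Fin R) :
    Function.update f r 0 ∈ S.capacityRegion := by
  classical
  rw [capacityRegion_eq_image] at hf ⊢
  obtain ⟨x, ⟨h1, h2, h3, h4, h5, h6⟩, rfl⟩ := hf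
  refine ⟨(x.1, fun m k b => ∑ c with Function.update c r 0 = b, x.2 m k c),
    ⟨h1, h2, h3, fun m k b => Finset.sum_nonneg fun c _ => h4 m k c, fun m k b hb =>
      Finset.sum_eq_zero fun c hc => h5 m k c fun hc' => hb ?_, fun m k => ?_⟩, ?_⟩
  · rw [← (Finset.mem_filter.1 hc).2]
    exact S.update_zero_mem_services hc' r
  · rw [← h6]
    exact Finset.sum_fiberwise _ _ _
  · have hlin : ∀ g : Fin R → ℝ, Function.update g r 0 = fun i => if i = r then 0 else g i :=
      fun g => by
        ext i
        simp [Function.update_apply]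
    have hb : ∀ b : BinVec R, BinVec.toReal (Function.update b r 0) =
        fun i => if i = r then 0 else b.toReal i := fun b => by
      ext i
      simp only [BinVec.toReal_apply, Function.update_apply]
      split_ifs <;> simp
    have hfib : ∀ m k, ∑ b : BinVec R, (∑ c with Function.update c r 0 = b, x.2 m k c) • b.toReal =
        ∑ c, x.2 m k c • BinVec.toReal (Function.update c r 0) := fun m k => by
      rw [← Finset.sum_fiberwise Finset.univ (fun c : BinVec R => (Function.update c r 0 : BinVec R))
        (fun c => x.2 m k c • BinVec.toReal (Function.update c r 0))]
      refine Finset.sum_congr rfl fun b _ => ?_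
      rw [Finset.sum_smul]
      refine Finset.sum_congr rfl fun c hc => ?_
      rw [(Finset.mem_filter.1 hc).2]
    rw [meanService_apply, meanService_apply, hlin]
    simp only [hfib, hb]
    ext i
    simp only [Finset.sum_apply, Pi.smul_apply, smul_eq_mul]
    split_ifs <;> simp

lemma update_mem_capacityRegion {f : Fin R → ℝ} (hf : f ∈ S.capacityRegion) (r : Fin R) {c : ℝ}
    (hc : 0 ≤ c) (hcf : c ≤ f r) : Function.update f r c ∈ S.capacityRegion := by
  have hmem := S.convex_capacityRegion.segment_subset (S.update_zero_mem_capacityRegion hf r) hf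
  -- If `f r = 0` then `c = 0` as well, and the convention `c / 0 = 0` selects an endpoint that
  -- already has the right coordinate.
  refine hmem ⟨1 - c / f r, c / f r, ?_, div_nonneg hc (hc.trans hcf), by ring, ?_⟩
  · rw [sub_nonneg]
    exact div_le_one_of_le₀ hcf (hc.trans hcf)
  · ext i
    rcases eq_or_ne i r with rfl | h
    · rcases eq_or_ne (f i) 0 with h0 | h0
      · simp [h0, le_antisymm (h0 ▸ hcf) hc]
      · simp [h0]
    · simp only [Pi.add_apply, Pi.smul_apply, smul_eq_mul, Function.update_of_ne h]
      ring

/-- The coordinates are lowered from `f` to `g` one at a time. -/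
lemma mem_capacityRegion_of_le {f g : Fin R → ℝ} (hf : f ∈ S.capacityRegion) (hg : ∀ r, 0 ≤ g r)
    (hgf : ∀ r, g r ≤ f r) : g ∈ S.capacityRegion := by
  classical
  have key : ∀ s : Finset (Fin R), s.piecewise g f ∈ S.capacityRegion := fun s => by
    induction s using Finset.induction_on with
    | empty => simpa using hf
    | insert r s hr ih =>
      rw [Finset.piecewise_insert]
      exact S.update_mem_capacityRegion ih r (hg r) (by simpa [hr] using hgf r)
  simpa using key Finset.univ

end QuantumSwitch

/-! ### Finite distributions, the strong law and measurability -/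

open MeasureTheory ProbabilityTheory

/-- The strong law of large numbers for a function of i.i.d. draws from a finite distribution. -/
lemma PMF.ae_tendsto_average {α E : Type*} [Fintype α] [MeasurableSpace α]
    [MeasurableSingletonClass α] [NormedAddCommGroup E] [NormedSpace ℝ E] [CompleteSpace E]
    [MeasurableSpace E] [BorelSpace E] (q : PMF α) (g : α → E) :
    ∀ᵐ ω ∂Measure.infinitePi (fun _ : ℕ => q.toMeasure),
      Filter.Tendsto (fun T : ℕ => (T : ℝ)⁻¹ • ∑ t ∈ Finset.range T, g (ω t)) Filter.atTop
        (nhds (∑ a, (q a).toReal • g a)) := by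
  have hg : Measurable g := measurable_of_countable g
  have hmp := fun i => measurePreserving_eval_infinitePi (fun _ : ℕ => q.toMeasure) i
  have hint : Integrable g q.toMeasure := .of_finite
  have hmean : ∫ ω, g (ω 0) ∂Measure.infinitePi (fun _ : ℕ => q.toMeasure) =
      ∑ a, (q a).toReal • g a := by
    rw [← PMF.integral_eq_sum]
    have h := integral_map (μ := Measure.infinitePi fun _ : ℕ => q.toMeasure)
      (hmp 0).measurable.aemeasurable (f := g)
      ((hmp 0).map_eq.symm ▸ hint.aestronglyMeasurable)
    rw [(hmp 0).map_eq] at h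
    exact h.symm
  rw [← hmean]
  refine strong_law_ae (fun t (ω : ℕ → α) => g (ω t)) ((hmp 0).integrable_comp_of_integrable hint)
    ?_ ?_
  · intro i j hij
    exact (iIndepFun_infinitePi (P := fun _ : ℕ => q.toMeasure) (X := fun _ => g)
      fun _ => hg).indepFun hij
  · intro i
    refine ⟨(hg.comp (measurable_pi_apply i)).aemeasurable,
      (hg.comp (measurable_pi_apply 0)).aemeasurable, ?_⟩
    have h : ∀ j : ℕ, Measure.map (fun ω : ℕ → α => g (ω j))
        (Measure.infinitePi fun _ : ℕ => q.toMeasure) = q.toMeasure.map g := fun j => by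
      rw [← congrArg (Measure.map g) (hmp j).map_eq, Measure.map_map hg (hmp j).measurable]
      rfl
    rw [h i, h 0]

lemma PMF.exists_apply_eq_ofReal {α : Type*} (s : Finset α) (g : α → ℝ) (hg : ∀ a ∈ s, 0 ≤ g a)
    (hg1 : ∑ a ∈ s, g a = 1) :
    ∃ q : PMF α, (∀ a ∈ s, q a = ENNReal.ofReal (g a)) ∧ ∀ a ∉ s, q a = 0 := by
  classical
  refine ⟨PMF.ofFinset (fun a => if a ∈ s then ENNReal.ofReal (g a) else 0) s ?_ ?_, ?_, ?_⟩
  · rw [Finset.sum_congr rfl fun a ha => if_pos ha, ← ENNReal.ofReal_sum_of_nonneg hg, hg1,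
      ENNReal.ofReal_one]
  · exact fun a ha => if_neg ha
  · exact fun a ha => if_pos ha
  · exact fun a ha => if_neg ha

lemma PMF.sum_coe_eq_one {α : Type*} [Fintype α] (q : PMF α) : ∑ a, q a = 1 := by
  rw [← tsum_fintype (L := .unconditional _), q.tsum_coe]

/-- The joint law of three successive draws. -/
noncomputable def PMF.bind₃ {α β γ : Type*} [Fintype α] [Fintype β] [Fintype γ] (q : PMF α)
    (c : α → PMF β) (d : α → β → PMF γ) : PMF (α × β × γ) :=
  PMF.ofFintype (fun y => q y.1 * c y.1 y.2.1 * d y.1 y.2.1 y.2.2) <| by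
    simp only [Fintype.sum_prod_type, ← Finset.mul_sum, PMF.sum_coe_eq_one, mul_one]

lemma PMF.bind₃_apply {α β γ : Type*} [Fintype α] [Fintype β] [Fintype γ] (q : PMF α)
    (c : α → PMF β) (d : α → β → PMF γ) (y : α × β × γ) :
    q.bind₃ c d y = q y.1 * c y.1 y.2.1 * d y.1 y.2.1 y.2.2 := rfl

lemma BinVec.measurable_toReal {n : ℕ} : Measurable (BinVec.toReal (n := n)) :=
  measurable_of_countable _

lemma measurable_serviceSeq {N R : ℕ} : Measurable (serviceSeq (N := N) (R := R)) :=
  measurable_pi_lambda _ fun t => ((measurable_pi_apply t).snd.snd.snd)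

lemma measurableSet_hasLongTermAverage {R : ℕ} (f : Fin R → ℝ) :
    MeasurableSet {v : ℕ → BinVec R | HasLongTermAverage v f} := by
  refine measurableSet_tendsto (nhds f)
    (f := fun (T : ℕ) (v : ℕ → BinVec R) =>
      (1 / (T : ℝ)) • ∑ t ∈ Finset.range T, (v t).toReal) fun T => ?_
  exact (Finset.measurable_fun_sum _ fun t _ =>
    BinVec.measurable_toReal.comp (measurable_pi_apply t)).const_smul (1 / (T : ℝ))

lemma measurableSet_hasLongTermAverage_serviceSeq {N R : ℕ} (f : Fin R → ℝ) :
    MeasurableSet {ω : ℕ → Slot N R | HasLongTermAverage (serviceSeq ω) f} :=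
  measurable_serviceSeq (measurableSet_hasLongTermAverage f)

/-! ### Achievability by stationary policies -/

namespace QuantumSwitch

variable {N R : ℕ} {S : QuantumSwitch N R}

/-- The joint law of (m,k,b) in one slot is itself a point of `slotWeights`; this puts the
conditional means of every policy in Λ. -/
lemma sum_bind₃_mem_capacityRegion (q : PMF (BinVec N))
    (d : BinVec N → BinVec N → PMF (BinVec R)) (hq : ∀ m ∈ q.support, m ∈ S.allocations)
    (hd : ∀ m ∈ S.allocations, ∀ k ∈ S.connectivities m, ∀ b ∈ (d m k).support,
      b ∈ S.services m k) :
    ∑ y, (q.bind₃ S.connLaw d y).toReal • y.2.2.toReal ∈ S.capacityRegion := by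
  rw [capacityRegion_eq_image]
  have h1 : ∀ {n : ℕ} (p : PMF (BinVec n)), ∑ x, (p x).toReal = 1 := fun p => by
    rw [← ENNReal.toReal_sum fun x _ => p.apply_ne_top x, p.sum_coe_eq_one,
      ENNReal.toReal_one]
  have hq0 : ∀ m, m ∉ S.allocations → q m = 0 := fun m hm =>
    (PMF.apply_eq_zero_iff _ _).2 fun h => hm (hq m h)
  refine ⟨(fun m => (q m).toReal, fun m k b => (q.bind₃ S.connLaw d (m, k, b)).toReal),
    ⟨fun m => ENNReal.toReal_nonneg, fun m hm => by simp [hq0 m hm], h1 q,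
      fun m k b => ENNReal.toReal_nonneg, fun m k b hb => ?_, fun m k => ?_⟩, ?_⟩
  · simp only [PMF.bind₃_apply]
    by_cases hm : m ∈ S.allocations
    · by_cases hk : k ∈ S.connectivities m
      · simp [(PMF.apply_eq_zero_iff (d m k) b).2 fun h => hb (hd m hm k hk b h)]
      · simp [connLaw_eq_zero S hm hk]
    · simp [hq0 m hm]
  · simp [PMF.bind₃_apply, ← Finset.mul_sum, h1, connProb]
  · simp only [meanService_apply, Fintype.sum_prod_type]

lemma exists_eq_sum_bind₃ {f : Fin R → ℝ} (hf : f ∈ S.capacityRegion) :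
    ∃ (q : PMF (BinVec N)) (d : BinVec N → BinVec N → PMF (BinVec R)),
      (∀ m ∈ q.support, m ∈ S.allocations) ∧
      (∀ m ∈ S.allocations, ∀ k ∈ S.connectivities m, ∀ b ∈ (d m k).support,
        b ∈ S.services m k) ∧
      f = ∑ y, (q.bind₃ S.connLaw d y).toReal • y.2.2.toReal := by
  classical
  obtain ⟨θ, δ, hθ, hθ1, hδ, hδ1, rfl⟩ := hf
  obtain ⟨q, hq, hq0⟩ := PMF.exists_apply_eq_ofReal S.allocations θ hθ hθ1
  have hex : ∀ m k, ∃ p : PMF (BinVec R), m ∈ S.allocations → k ∈ S.connectivities m →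
      (∀ b ∈ S.services m k, p b = ENNReal.ofReal (δ m k b)) ∧ ∀ b ∉ S.services m k, p b = 0 := by
    intro m k
    by_cases h : m ∈ S.allocations ∧ k ∈ S.connectivities m
    · obtain ⟨p, hp⟩ := PMF.exists_apply_eq_ofReal _ _ (hδ m h.1 k h.2) (hδ1 m h.1 k h.2)
      exact ⟨p, fun _ _ => hp⟩
    -- A dummy value: outside the admissible pairs nothing is required of the rule.
    · exact ⟨PMF.pure 0, fun h1 h2 => absurd ⟨h1, h2⟩ h⟩
  choose d hd using hex
  refine ⟨q, d, fun m hm => ?_, fun m hm k hk b hb => ?_, ?_⟩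
  · by_contra h
    exact (PMF.mem_support_iff _ _).1 hm (hq0 m h)
  · by_contra h
    exact (PMF.mem_support_iff _ _).1 hb ((hd m k hm hk).2 b h)
  · simp only [Fintype.sum_prod_type, PMF.bind₃_apply]
    rw [← Finset.sum_subset (Finset.subset_univ S.allocations)]
    · refine Finset.sum_congr rfl fun m hm => ?_
      rw [← Finset.sum_subset (Finset.subset_univ (S.connectivities m)), Finset.smul_sum]
      · refine Finset.sum_congr rfl fun k hk => ?_
        rw [← Finset.sum_subset (Finset.subset_univ (S.services m k)), Finset.smul_sum,
          Finset.smul_sum]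
        · refine Finset.sum_congr rfl fun b hb => ?_
          rw [hq m hm, (hd m k hm hk).1 b hb, ENNReal.toReal_mul, ENNReal.toReal_mul,
            ENNReal.toReal_ofReal (hθ m hm), ENNReal.toReal_ofReal (hδ m hm k hk b hb), smul_smul,
            smul_smul, mul_assoc, mul_assoc]
          rfl
        · intro b _ hb
          simp [(hd m k hm hk).2 b hb]
      · intro k _ hk
        simp [connLaw_eq_zero S hm hk]
    · intro m _ hm
      simp [hq0 m hm]

/-- For T = 0 the cylinder is the whole space and the product is empty, so P and ν have the same
total mass. -/
lemma Policy.IsLaw.isProbabilityMeasure {π : S.Policy} {ν : Measure (ℕ → BinVec R)}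
    [IsProbabilityMeasure ν] {P : Measure (ℕ → Slot N R)} (hP : π.IsLaw ν P) :
    IsProbabilityMeasure P :=
  ⟨by simpa using hP 0 fun _ => 0⟩

/-- The policy that repeats the same randomized decision rule in every slot. -/
def stationaryPolicy (q : PMF (BinVec N)) (d : BinVec N → BinVec N → PMF (BinVec R))
    (hq : ∀ m ∈ q.support, m ∈ S.allocations)
    (hd : ∀ m ∈ S.allocations, ∀ k ∈ S.connectivities m, ∀ b ∈ (d m k).support,
      b ∈ S.services m k) : S.Policy where
  alloc _ _ _ := q
  serve _ _ _ := d
  alloc_mem _ _ _ := hq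
  serve_mem _ _ _ := hd

/-- Under the product of ν with i.i.d. copies of the one-slot law, cylinder probabilities factor
exactly as `IsLaw` demands. -/
lemma exists_policy_hasServiceRate {f : Fin R → ℝ} (hf : f ∈ S.capacityRegion)
    (ν : Measure (ℕ → BinVec R)) [IsProbabilityMeasure ν] :
    ∃ π : S.Policy, π.HasServiceRate ν f := by
  obtain ⟨q, d, hq, hd, rfl⟩ := exists_eq_sum_bind₃ hf
  have hΦ : Measurable fun (z : (ℕ → BinVec R) × (ℕ → BinVec N × BinVec N × BinVec R)) (t : ℕ) =>
      ((z.1 t, z.2 t) : Slot N R) := by fun_prop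
  refine ⟨stationaryPolicy q d hq hd,
    (ν.prod (Measure.infinitePi fun _ => (q.bind₃ S.connLaw d).toMeasure)).map
      fun z t => (z.1 t, z.2 t), fun T x => ?_, ?_⟩
  · have hset : MeasurableSet {ω : ℕ → Slot N R | ∀ t < T, ω t = x t} := by
      simp only [Set.ofPred_forall]
      exact MeasurableSet.iInter fun t => MeasurableSet.iInter fun _ =>
        measurableSet_eq_fun (measurable_pi_apply t) measurable_const
    have hpre : (fun (z : (ℕ → BinVec R) × (ℕ → BinVec N × BinVec N × BinVec R)) (t : ℕ) =>
        ((z.1 t, z.2 t) : Slot N R)) ⁻¹' {ω | ∀ t < T, ω t = x t} =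
        {a | ∀ t < T, a t = (x t).1} ×ˢ
          ((Finset.range T : Set ℕ).pi fun t => {(x t).2}) := by
      ext z
      simp [Prod.ext_iff, Set.mem_pi, forall_and]
    rw [Measure.map_apply hΦ hset, hpre, Measure.prod_prod,
      Measure.infinitePi_pi _ fun t _ => measurableSet_singleton _]
    congr 1
    refine Finset.prod_congr rfl fun t _ => ?_
    rw [PMF.toMeasure_apply_singleton _ _ (measurableSet_singleton _)]
    rfl
  · rw [ae_map_iff hΦ.aemeasurable (measurableSet_hasLongTermAverage_serviceSeq _)]
    have h := PMF.ae_tendsto_average (q.bind₃ S.connLaw d) fun y => y.2.2.toReal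
    have h' := Measure.quasiMeasurePreserving_snd (μ := ν)
      (ν := Measure.infinitePi fun _ : ℕ => (q.bind₃ S.connLaw d).toMeasure) |>.ae h
    filter_upwards [h'] with z hz
    simpa only [HasLongTermAverage, serviceSeq, one_div] using hz

/-- Service vectors are binary, so the service process of a policy with rate `f` can itself play the
role of an arrival process. The arrivals feeding that policy are irrelevant; the zero sequence is
used. -/
lemma exists_hasArrivalRate {f : Fin R → ℝ} (hf : f ∈ S.capacityRegion) :
    ∃ ν : Measure (ℕ → BinVec R), IsProbabilityMeasure ν ∧ HasArrivalRate ν f := by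
  obtain ⟨π, P, hP, hlim⟩ := exists_policy_hasServiceRate hf (Measure.dirac 0)
  have := hP.isProbabilityMeasure
  refine ⟨P.map serviceSeq, Measure.isProbabilityMeasure_map measurable_serviceSeq.aemeasurable, ?_⟩
  rw [HasArrivalRate, ae_map_iff measurable_serviceSeq.aemeasurable
    (measurableSet_hasLongTermAverage _)]
  exact hlim

end QuantumSwitch

/-! ### Averages of bounded orthogonal variables -/

section Orthogonal

variable {Ω : Type*} [MeasurableSpace Ω] {μ : Measure Ω} [IsProbabilityMeasure μ] {D : ℕ → Ω → ℝ}

/-- Orthogonality kills the cross terms, and each diagonal term contributes at most 1. -/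
lemma integral_sq_sum_le (hD : ∀ t, Measurable (D t)) (hbd : ∀ t ω, |D t ω| ≤ 1)
    (horth : ∀ s t, s < t → ∫ ω, D s ω * D t ω ∂μ = 0) (T : ℕ) :
    ∫ ω, (∑ t ∈ Finset.range T, D t ω) ^ 2 ∂μ ≤ T := by
  have hint : ∀ s t, Integrable (fun ω => D s ω * D t ω) μ := fun s t =>
    .of_bound ((hD s).mul (hD t)).aestronglyMeasurable 1 <| .of_forall fun ω => by
      rw [Real.norm_eq_abs, abs_mul]
      exact mul_le_one₀ (hbd s ω) (abs_nonneg _) (hbd t ω)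
  have hsq : ∀ T, Integrable (fun ω => (∑ t ∈ Finset.range T, D t ω) ^ 2) μ := fun T => by
    simp only [sq, Finset.sum_mul_sum]
    exact integrable_finsetSum _ fun s _ => integrable_finsetSum _ fun t _ => hint s t
  induction T with
  | zero => simp
  | succ T ih =>
    have hcross : Integrable (fun ω => ∑ s ∈ Finset.range T, D s ω * D T ω) μ :=
      integrable_finsetSum _ fun s _ => hint s T
    have hlast : ∫ ω, D T ω * D T ω ∂μ ≤ 1 := by
      have h := integral_mono (hint T T) (integrable_const 1) fun ω => by
        have := abs_le.1 (hbd T ω)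
        show D T ω * D T ω ≤ 1
        nlinarith
      simpa using h
    have hexp : ∀ ω, (∑ t ∈ Finset.range (T + 1), D t ω) ^ 2 =
        (∑ t ∈ Finset.range T, D t ω) ^ 2 + 2 * (∑ s ∈ Finset.range T, D s ω * D T ω) +
          D T ω * D T ω := fun ω => by
      rw [Finset.sum_range_succ, ← Finset.sum_mul]
      ring
    simp only [hexp]
    have hfirst : Integrable (fun ω => (∑ t ∈ Finset.range T, D t ω) ^ 2 +
        2 * ∑ s ∈ Finset.range T, D s ω * D T ω) μ := (hsq T).add (hcross.const_mul 2)
    rw [integral_add hfirst (hint T T),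
      integral_add (hsq T) (hcross.const_mul 2), integral_const_mul,
      integral_finsetSum _ fun s _ => hint s T,
      Finset.sum_eq_zero fun s hs => horth s T (Finset.mem_range.1 hs)]
    push_cast
    linarith

/-- Averages of uniformly bounded orthogonal random variables vanish along the squares. -/
lemma ae_tendsto_average_sq (hD : ∀ t, Measurable (D t)) (hbd : ∀ t ω, |D t ω| ≤ 1)
    (horth : ∀ s t, s < t → ∫ ω, D s ω * D t ω ∂μ = 0) :
    ∀ᵐ ω ∂μ, Filter.Tendsto (fun n : ℕ =>
      (1 / (((n + 1) ^ 2 : ℕ) : ℝ)) * ∑ t ∈ Finset.range ((n + 1) ^ 2), D t ω)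
      Filter.atTop (nhds 0) := by
  set X : ℕ → Ω → ℝ := fun n ω =>
    (1 / (((n + 1) ^ 2 : ℕ) : ℝ)) * ∑ t ∈ Finset.range ((n + 1) ^ 2), D t ω with hX
  have hmeas : ∀ n, Measurable (X n) := fun n =>
    (Finset.measurable_fun_sum _ fun t _ => hD t).const_mul _
  -- The average of T terms has second moment at most 1/T. This is summable along T = (n+1)², so the
  -- squares of these averages have an almost surely finite sum and tend to 0.
  have hbound : ∀ n, ∫⁻ ω, ENNReal.ofReal (X n ω ^ 2) ∂μ ≤
      ENNReal.ofReal (1 / ((n : ℝ) + 1) ^ 2) := fun n => by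
    have hint : Integrable (fun ω => X n ω ^ 2) μ :=
      .of_bound ((hmeas n).pow_const 2).aestronglyMeasurable 1 <| .of_forall fun ω => by
        have h : |X n ω| ≤ 1 := by
          rw [hX, abs_mul, abs_of_nonneg (by positivity), one_div, inv_mul_le_one₀ (by positivity)]
          refine (Finset.abs_sum_le_sum_abs _ _).trans ?_
          simpa only [Finset.sum_const, Finset.card_range, nsmul_eq_mul, mul_one] using
            Finset.sum_le_sum fun t (_ : t ∈ Finset.range ((n + 1) ^ 2)) => hbd t ω
        rw [Real.norm_eq_abs, abs_pow]
        exact pow_le_one₀ (abs_nonneg _) h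
    rw [← ofReal_integral_eq_lintegral_ofReal hint (.of_forall fun ω => sq_nonneg _)]
    refine ENNReal.ofReal_le_ofReal ?_
    simp only [hX, mul_pow, integral_const_mul]
    refine (mul_le_mul_of_nonneg_left (integral_sq_sum_le hD hbd horth _)
      (by positivity)).trans_eq ?_
    push_cast
    field_simp
  have hsummable : Summable fun n : ℕ => 1 / ((n : ℝ) + 1) ^ 2 := by
    have h := (summable_nat_add_iff 1).2 (Real.summable_one_div_nat_pow.2 one_lt_two)
    simpa using h
  have hlt : ∫⁻ ω, ∑' n, ENNReal.ofReal (X n ω ^ 2) ∂μ < ⊤ := by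
    rw [lintegral_tsum fun n => ((hmeas n).pow_const 2).ennreal_ofReal.aemeasurable]
    refine (ENNReal.tsum_le_tsum hbound).trans_lt ?_
    rw [← ENNReal.ofReal_tsum_of_nonneg (fun n => by positivity) hsummable]
    exact ENNReal.ofReal_lt_top
  filter_upwards [ae_lt_top (Measurable.tsum fun n =>
    ((hmeas n).pow_const 2).ennreal_ofReal) hlt.ne] with ω hω
  have h0 := ENNReal.tendsto_atTop_zero_of_tsum_ne_top hω.ne
  have h1 : Filter.Tendsto (fun n => X n ω ^ 2) Filter.atTop (nhds 0) := by
    have h := (ENNReal.tendsto_toReal ENNReal.zero_ne_top).comp h0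
    simpa [Function.comp_def, ENNReal.toReal_ofReal (sq_nonneg _)] using h
  change Filter.Tendsto (fun n => X n ω) Filter.atTop (nhds 0)
  rw [tendsto_zero_iff_abs_tendsto_zero]
  have h2 := (Real.continuous_sqrt.tendsto 0).comp h1
  simpa only [Function.comp_def, Real.sqrt_sq_eq_abs, Real.sqrt_zero] using h2

end Orthogonal

/-! ### Converse: conditional means and orthogonal noise -/

namespace QuantumSwitch

variable {N R : ℕ} {S : QuantumSwitch N R}

lemma Policy.stepProb_eq_bind₃ (π : S.Policy) (t : ℕ) (h : Fin t → Slot N R) (a : BinVec R)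
    (y : BinVec N × BinVec N × BinVec R) :
    π.stepProb t h (a, y) = (π.alloc t h a).bind₃ S.connLaw (π.serve t h a) y := rfl

/-- The conditional mean of the service vector, given the past and the current arrivals. -/
noncomputable def Policy.condMean (π : S.Policy) (t : ℕ) (h : Fin t → Slot N R) (a : BinVec R) :
    Fin R → ℝ :=
  ∑ y : BinVec N × BinVec N × BinVec R, (π.stepProb t h (a, y)).toReal • y.2.2.toReal

lemma Policy.condMean_mem_capacityRegion (π : S.Policy) (t : ℕ) (h : Fin t → Slot N R)
    (a : BinVec R) : π.condMean t h a ∈ S.capacityRegion := by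
  simp only [condMean, stepProb_eq_bind₃]
  exact sum_bind₃_mem_capacityRegion _ _ (π.alloc_mem t h a) (π.serve_mem t h a)

lemma Policy.sum_stepProb (π : S.Policy) (t : ℕ) (h : Fin t → Slot N R) (a : BinVec R) :
    ∑ y : BinVec N × BinVec N × BinVec R, (π.stepProb t h (a, y)).toReal = 1 := by
  simp only [stepProb_eq_bind₃]
  rw [← ENNReal.toReal_sum fun y _ => PMF.apply_ne_top _ y, PMF.sum_coe_eq_one, ENNReal.toReal_one]

lemma Policy.condMean_apply (π : S.Policy) (t : ℕ) (h : Fin t → Slot N R) (a : BinVec R)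
    (r : Fin R) : π.condMean t h a r = ∑ y : BinVec N × BinVec N × BinVec R,
      (π.stepProb t h (a, y)).toReal * y.2.2.toReal r := by
  simp only [condMean, Finset.sum_apply, Pi.smul_apply, smul_eq_mul]

/-- The deviation of the service given to requests of type `r` from its conditional mean. -/
noncomputable def Policy.noise (π : S.Policy) (r : Fin R) (t : ℕ) (h : Fin t → Slot N R)
    (x : Slot N R) : ℝ :=
  x.2.2.2.toReal r - π.condMean t h x.1 r

lemma Policy.abs_noise_le (π : S.Policy) (r : Fin R) (t : ℕ) (h : Fin t → Slot N R)
    (x : Slot N R) : |π.noise r t h x| ≤ 1 := by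
  have h0 : 0 ≤ π.condMean t h x.1 r := by
    rw [condMean_apply]
    exact Finset.sum_nonneg fun y _ =>
      mul_nonneg ENNReal.toReal_nonneg (BinVec.toReal_apply_nonneg _ _)
  have h1 : π.condMean t h x.1 r ≤ 1 := by
    rw [condMean_apply, ← π.sum_stepProb t h x.1]
    exact Finset.sum_le_sum fun y _ =>
      mul_le_of_le_one_right ENNReal.toReal_nonneg (BinVec.toReal_apply_le_one _ _)
  have h2 := BinVec.toReal_apply_nonneg x.2.2.2 r
  have h3 := BinVec.toReal_apply_le_one x.2.2.2 r
  rw [noise, abs_le]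
  constructor <;> linarith

lemma Policy.sum_stepProb_mul_noise (π : S.Policy) (r : Fin R) (t : ℕ) (h : Fin t → Slot N R)
    (a : BinVec R) : ∑ y : BinVec N × BinVec N × BinVec R,
      (π.stepProb t h (a, y)).toReal * π.noise r t h (a, y) = 0 := by
  simp only [noise, mul_sub, Finset.sum_sub_distrib, ← Finset.sum_mul, sum_stepProb,
    condMean_apply]
  simp

/-- The constant collects the probability of the arrivals through slot `t` and the step
probabilities of the past. Exogeneity of the arrivals makes it independent of `y`, so no conditional
expectations are needed. -/
lemma Policy.IsLaw.exists_measure_history_eq {π : S.Policy} {ν : Measure (ℕ → BinVec R)}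
    {P : Measure (ℕ → Slot N R)} (hP : π.IsLaw ν P) (t : ℕ) (h : Fin t → Slot N R)
    (a : BinVec R) :
    ∃ c : ENNReal, ∀ y, P {ω | (∀ i : Fin t, ω i = h i) ∧ ω t = (a, y)} =
      c * π.stepProb t h (a, y) := by
  refine ⟨ν {α | (∀ i : Fin t, α i = (h i).1) ∧ α t = a} *
    ∏ i : Fin t, π.stepProb i (fun j => h ⟨j, j.2.trans i.2⟩) (h i), fun y => ?_⟩
  -- Values beyond slot `t` are arbitrary, as the cylinder of length `t + 1` does not see them.
  set x : ℕ → Slot N R := fun u => if hu : u < t then h ⟨u, hu⟩ else (a, y) with hx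
  have hxi : ∀ i : Fin t, x i = h i := fun i => by simp [hx]
  have hxt : x t = (a, y) := by simp [hx]
  have hlt : ∀ p : ℕ → Prop, (∀ u < t + 1, p u) ↔ (∀ i : Fin t, p i) ∧ p t := fun p => by
    rw [Nat.forall_lt_succ_right, Fin.forall_iff]
  have key := hP (t + 1) x
  simp only [hlt, hxi, hxt, Finset.prod_range_succ] at key
  rw [key, Finset.prod_range, mul_assoc]
  simp only [hxi]
  congr 2
  refine Finset.prod_congr rfl fun i _ => ?_
  congr 1
  funext j
  exact hxi ⟨j, j.2.trans i.2⟩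

/-- Tower property in finite form: a function with zero conditional mean given history and current
arrivals has zero mean, by summing over the finitely many histories and arrivals. -/
lemma Policy.IsLaw.integral_eq_zero {π : S.Policy} {ν : Measure (ℕ → BinVec R)}
    {P : Measure (ℕ → Slot N R)} [IsProbabilityMeasure P] (hP : π.IsLaw ν P) {t : ℕ}
    (φ : (Fin t → Slot N R) → Slot N R → ℝ)
    (hφ : ∀ h a, ∑ y, (π.stepProb t h (a, y)).toReal * φ h (a, y) = 0) :
    ∫ ω, φ (fun i => ω i) (ω t) ∂P = 0 := by
  set ρ : (ℕ → Slot N R) → (Fin t → Slot N R) × Slot N R := fun ω => (fun i => ω i, ω t) with hρ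
  have hρm : Measurable ρ := by fun_prop
  have hprob : IsProbabilityMeasure (P.map ρ) := Measure.isProbabilityMeasure_map hρm.aemeasurable
  have hmap : ∫ ω, φ (fun i => ω i) (ω t) ∂P = ∫ z, φ z.1 z.2 ∂P.map ρ :=
    (integral_map hρm.aemeasurable
      (Integrable.of_finite (f := fun z : (Fin t → Slot N R) × Slot N R =>
        φ z.1 z.2)).aestronglyMeasurable).symm
  rw [hmap, integral_fintype .of_finite, Fintype.sum_prod_type]
  refine Finset.sum_eq_zero fun h _ => ?_
  rw [Fintype.sum_prod_type]
  refine Finset.sum_eq_zero fun a _ => ?_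
  obtain ⟨c, hc⟩ := hP.exists_measure_history_eq t h a
  have hreal : ∀ y, (P.map ρ).real {(h, (a, y))} = c.toReal * (π.stepProb t h (a, y)).toReal :=
    fun y => by
      rw [Measure.real, Measure.map_apply hρm (measurableSet_singleton _), ← ENNReal.toReal_mul,
        ← hc]
      congr 2
      ext ω
      simp [hρ, funext_iff, Prod.ext_iff]
  simp only [hreal, smul_eq_mul, mul_assoc, ← Finset.mul_sum, hφ, mul_zero]

/-- The limit of the averages of the service vectors lies in the capacity region. -/
lemma Policy.IsLaw.ae_mem_capacityRegion {π : S.Policy} {ν : Measure (ℕ → BinVec R)}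
    [IsProbabilityMeasure ν] {P : Measure (ℕ → Slot N R)} (hP : π.IsLaw ν P) :
    ∀ᵐ ω ∂P, ∀ f : Fin R → ℝ, HasLongTermAverage (serviceSeq ω) f → f ∈ S.capacityRegion := by
  have := hP.isProbabilityMeasure
  have hnoise : ∀ r, ∀ᵐ ω ∂P, Filter.Tendsto (fun n : ℕ =>
      (1 / (((n + 1) ^ 2 : ℕ) : ℝ)) * ∑ t ∈ Finset.range ((n + 1) ^ 2),
        π.noise r t (fun i => ω i) (ω t)) Filter.atTop (nhds 0) := fun r => by
    refine ae_tendsto_average_sq (D := fun t (ω : ℕ → Slot N R) => π.noise r t (fun i => ω i) (ω t))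
      (fun t => ?_) (fun t ω => π.abs_noise_le r t _ _) fun s t hst => ?_
    · exact (measurable_of_countable fun z : (Fin t → Slot N R) × Slot N R =>
        π.noise r t z.1 z.2).comp (by fun_prop : Measurable fun ω : ℕ → Slot N R =>
          ((fun i : Fin t => ω i, ω t) : (Fin t → Slot N R) × Slot N R))
    -- The noise of slot `s < t` is a function of the history before `t`, so it factors out of the
    -- conditional mean of the noise of slot `t`.
    · refine hP.integral_eq_zero (fun h x =>
        π.noise r s (fun i => h ⟨i, i.2.trans hst⟩) (h ⟨s, hst⟩) * π.noise r t h x) fun h a => ?_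
      simp only [mul_left_comm _ (π.noise r s _ _), ← Finset.mul_sum, sum_stepProb_mul_noise,
        mul_zero]
  filter_upwards [ae_all_iff.2 hnoise] with ω hω f hf
  have hsub : Filter.Tendsto (fun n : ℕ => (n + 1) ^ 2) Filter.atTop Filter.atTop :=
    Filter.tendsto_atTop_mono (fun n => (Nat.le_succ n).trans (Nat.le_self_pow two_ne_zero _)) Filter.tendsto_id
  -- Service average minus noise average is the average of the conditional means, a convex
  -- combination of points of Λ; the shift to (n+1)² keeps it nonempty.
  refine S.isClosed_capacityRegion.mem_of_tendsto (b := Filter.atTop)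
    (f := fun n : ℕ => (1 / (((n + 1) ^ 2 : ℕ) : ℝ)) • ∑ t ∈ Finset.range ((n + 1) ^ 2),
      π.condMean t (fun i => ω i) (ω t).1) ?_ (.of_forall fun n => ?_)
  · rw [tendsto_pi_nhds]
    intro r
    have h := ((tendsto_pi_nhds.1 hf r).comp hsub).sub (hω r)
    rw [sub_zero] at h
    refine h.congr fun n => ?_
    simp only [Function.comp_apply, Pi.smul_apply, Finset.sum_apply, smul_eq_mul, noise,
      Finset.sum_sub_distrib, mul_sub, serviceSeq, sub_sub_cancel]
  · rw [Finset.smul_sum]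
    refine S.convex_capacityRegion.sum_mem (fun _ _ => by positivity) ?_
      fun t _ => π.condMean_mem_capacityRegion t _ _
    rw [Finset.sum_const, Finset.card_range, nsmul_eq_mul, mul_one_div_cancel]
    positivity

end QuantumSwitch

/-! ### Supported rates and the main theorem -/

lemma HasArrivalRate.nonneg {R : ℕ} {ν : Measure (ℕ → BinVec R)} [IsProbabilityMeasure ν]
    {lam : Fin R → ℝ} (h : HasArrivalRate ν lam) (r : Fin R) : 0 ≤ lam r := by
  obtain ⟨a, ha⟩ := h.exists
  refine ge_of_tendsto' (tendsto_pi_nhds.1 ha r) fun T => ?_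
  simp only [Pi.smul_apply, Finset.sum_apply, smul_eq_mul]
  exact mul_nonneg (by positivity) (Finset.sum_nonneg fun t _ => BinVec.toReal_apply_nonneg _ _)

theorem proposition1 {N R : ℕ} (S : QuantumSwitch N R) :
    -- under any arrival process, the achievable long-term service vectors are the elements of `Λ`
    (∀ ν : MeasureTheory.Measure (ℕ → BinVec R), MeasureTheory.IsProbabilityMeasure ν →
      {f : Fin R → ℝ | ∃ π : S.Policy, π.HasServiceRate ν f} = S.capacityRegion) ∧
    -- no policy has, with positive probability, a (possibly random) limit outside `Λ`
    (∀ ν : MeasureTheory.Measure (ℕ → BinVec R), MeasureTheory.IsProbabilityMeasure ν →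
      ∀ (π : S.Policy) (P : MeasureTheory.Measure (ℕ → Slot N R)), π.IsLaw ν P →
        ∀ᵐ ω ∂P, ∀ f : Fin R → ℝ,
          HasLongTermAverage (serviceSeq ω) f → f ∈ S.capacityRegion) ∧
    -- an arrival process with rate `lam` can be supported iff `lam ∈ Λ`
    (∀ ν : MeasureTheory.Measure (ℕ → BinVec R), MeasureTheory.IsProbabilityMeasure ν →
      ∀ lam : Fin R → ℝ, HasArrivalRate ν lam →
        (S.Supports ν lam ↔ lam ∈ S.capacityRegion)) ∧
    -- the set of supportable arrival rates is `Λ`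
    S.supportableRates = S.capacityRegion := by
  have hrate : ∀ ν : MeasureTheory.Measure (ℕ → BinVec R), MeasureTheory.IsProbabilityMeasure ν →
      ∀ (π : S.Policy) (f : Fin R → ℝ), π.HasServiceRate ν f → f ∈ S.capacityRegion := by
    rintro ν _ π f ⟨P, hP, hf⟩
    have := hP.isProbabilityMeasure
    -- Since `f` is deterministic, one trajectory satisfying both almost sure properties is enough.
    obtain ⟨ω, h1, h2⟩ := (hP.ae_mem_capacityRegion.and hf).exists
    exact h1 f h2
  have hsupp : ∀ ν : MeasureTheory.Measure (ℕ → BinVec R), MeasureTheory.IsProbabilityMeasure ν →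
      ∀ lam : Fin R → ℝ, HasArrivalRate ν lam →
        (S.Supports ν lam ↔ lam ∈ S.capacityRegion) := by
    intro ν hν lam hlam
    constructor
    · rintro ⟨π, f, hf, hle⟩
      -- Domination alone would not suffice: Λ contains only nonnegative vectors, and an arrival
      -- rate is nonnegative.
      exact S.mem_capacityRegion_of_le (hrate ν hν π f hf) hlam.nonneg hle
    · intro h
      obtain ⟨π, hπ⟩ := QuantumSwitch.exists_policy_hasServiceRate h ν
      exact ⟨π, lam, hπ, fun _ => le_rfl⟩
  refine ⟨fun ν hν => ?_, fun ν _ π P hP => hP.ae_mem_capacityRegion, hsupp, ?_⟩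
  · ext f
    exact ⟨fun ⟨π, hπ⟩ => hrate ν hν π f hπ,
      fun hf => QuantumSwitch.exists_policy_hasServiceRate hf ν⟩
  · ext lam
    constructor
    · rintro ⟨ν, hν, hlam, hS⟩
      exact (hsupp ν hν lam hlam).1 hS
    · intro h
      obtain ⟨ν, hν, hlam⟩ := QuantumSwitch.exists_hasArrivalRate h
      exact ⟨ν, hν, hlam, (hsupp ν hν lam hlam).2 h⟩
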